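/- Let $n\ge 1$ and $s\ge 0$ be integers and $[n]=\{1,\dots,n\}$. An $(s+1)$-partition of $[n]$ is a tuple $(P,w^1,\dots,w^s)$ where $P$ is a partition of $[n]$ and each $w^i$ assigns to every part $I$ of $P$ a subset of $[n]$ with $|I|$ elements (the $i$th label of $I$), such that for each $i$ the $i$th labels of the parts form a partition of $[n]$. Let $\Pi_{n,s+1}$ be the set of $(s+1)$-partitions of $[n]$ together with an additional least element $\hat 0$, ordered by $(P,w^1,\dots,w^s)\le(P',w^{1\prime},\dots,w^{s\prime})$ if every part $J$ of $P'$ is a union of parts of $P$ and, for each $i$, the $i$th label of $J$ is the union of the $i$th labels of these parts. This is a finite bounded poset with greatest element $([n],\dots,[n])$. Its atoms are the elements $(\{1\}\cdots\{n\},\{w^1_1\}\cdots\{w^1_n\},\dots,\{w^s_1\}\cdots\{w^s_n\})$, where $\{w^i_k\}$ is the $i$th label of $\{k\}$; such an atom is identified with the word $w^1_1\cdots w^1_n\cdots\cdots w^s_1\cdots w^s_n$, and the atoms are ordered lexicographically by their words. For $x\in\Pi_{n,s+1}\setminus\{\hat 0\}$ let $A(x)$ be the lexicographically first atom $a\le x$,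 and let $w^i_k(x)$ denote the letters of its word. Define a labeling $\lambda$ of the edges (covering pairs) $x\lessdot y$ of $\Pi_{n,s+1}$ with values in $\mathbb Z\times\mathbb Z\times\mathbb Z$, ordered lexicographically, as follows. (a) If $x\ne\hat 0$ and $A(x)\neq A(y)$, then $\lambda(x\lessdot y)$ is the lexicographically first triple $(k,i,j)$, with $1\le k\le n$ and $1\le i\le s$, such that $w^i_k(x)\ne w^i_k(y)$ and $w^i_k(y)=j$. (b) If $x\ne\hat 0$ and $A(x)=A(y)$, then $\lambda(x\lessdot y)=(n,\max(I\cup J),0)$, where $I$ and $J$ are the two parts of the partition of $x$ that are merged to give the partition of $y$. (c) If $a$ is the $m$th atom in the lexicographic order of the atoms ($m=1,2,\dots$), then $\lambda(\hat 0\lessdot a)=(n-1,s+m,0)$. Then $\lambda$ is an EL-labeling of $\Pi_{n,s+1}$: for all $x\le y$ in $\Pi_{n,s+1}$, among the maximal chains $x=x_0\lessdot x_1\lessdot\cdots\lessdot x_r=y$ of the interval $[x,y]$ there is exactly one whose label word $\lambda(x_0\lessdot x_1)\lambda(x_1\lessdot x_2)\cdots\lambda(x_{r-1}\lessdot x_r)$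 is strictly increasing, and the label word of this chain strictly precedes the label words of all other maximal chains of $[x,y]$ in the lexicographic order. In particular, $\Pi_{n,s+1}$ is EL-shellable, that is, it admits an EL-labeling with values in a totally ordered set. -/

import Mathlib

/-- A vector partition of `[n]` into `s + 1` components: a partition of `[n]` together with `s`
labelings of its parts. The set `[n] = {1, …, n}` is modelled by `Fin n`, the element `k : Fin n`
standing for the integer `k + 1`. The labelings are functions on all finsets, normalised to be `∅`
off the parts, so that two vector partitions are equal iff they have the same parts and the same
labels on these parts. -/
@[ext]
structure VectorPartition (n s : ℕ) where
  partition : Finpartition (Finset.univ : Finset (Fin n))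
  label : Fin s → Finset (Fin n) → Finset (Fin n)
  card_label : ∀ i, ∀ I ∈ partition.parts, (label i I).card = I.card
  disjoint_label : ∀ i, ∀ I ∈ partition.parts, ∀ J ∈ partition.parts, I ≠ J →
    Disjoint (label i I) (label i J)
  union_label : ∀ i, partition.parts.biUnion (label i) = Finset.univ
  label_of_notMem : ∀ i I, I ∉ partition.parts → label i I = ∅

namespace VectorPartition

variable {n s : ℕ}

/-- The parts of `x` contained in the set `J`. -/
def partsIn (x : VectorPartition n s) (J : Finset (Fin n)) : Finset (Finset (Fin n)) :=
  {I ∈ x.partition.parts | I ⊆ J}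

/-- `x ≤ y` iff every part `J` of `y` is the union of parts of `x` (necessarily of those contained
in `J`), and each label of `J` is the union of the corresponding labels of these parts. -/
instance : LE (VectorPartition n s) where
  le x y := ∀ J ∈ y.partition.parts,
    (x.partsIn J).biUnion id = J ∧ ∀ i, (x.partsIn J).biUnion (x.label i) = y.label i J

theorem le_def {x y : VectorPartition n s} : x ≤ y ↔ ∀ J ∈ y.partition.parts,
    (x.partsIn J).biUnion id = J ∧ ∀ i, (x.partsIn J).biUnion (x.label i) = y.label i J :=
  Iff.rfl

theorem partsIn_self (x : VectorPartition n s) {J : Finset (Fin n)}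
    (hJ : J ∈ x.partition.parts) : x.partsIn J = {J} := by
  ext I
  simp only [partsIn, Finset.mem_filter, Finset.mem_singleton]
  constructor
  · rintro ⟨hI, hIJ⟩
    obtain ⟨a, ha⟩ := x.partition.nonempty_of_mem_parts hI
    exact x.partition.eq_of_mem_parts hI hJ ha (hIJ ha)
  · rintro rfl
    exact ⟨hJ, subset_rfl⟩

theorem exists_part_superset {x y : VectorPartition n s} (h : x ≤ y) {I : Finset (Fin n)}
    (hI : I ∈ x.partition.parts) : ∃ J ∈ y.partition.parts, I ⊆ J := by
  obtain ⟨a, ha⟩ := x.partition.nonempty_of_mem_parts hI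
  obtain ⟨J, hJ, haJ⟩ := y.partition.exists_mem (Finset.mem_univ a)
  refine ⟨J, hJ, ?_⟩
  rw [← (h J hJ).1, Finset.mem_biUnion] at haJ
  obtain ⟨I', hI', haI'⟩ := haJ
  obtain ⟨hI'x, hI'J⟩ := Finset.mem_filter.1 hI'
  rwa [x.partition.eq_of_mem_parts hI hI'x ha haI']

theorem partsIn_eq_biUnion {x y : VectorPartition n s} (h : x ≤ y) {K : Finset (Fin n)}
    (hK : (y.partsIn K).biUnion id = K) :
    x.partsIn K = (y.partsIn K).biUnion x.partsIn := by
  ext I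
  simp only [Finset.mem_biUnion]
  constructor
  · intro hI
    obtain ⟨hIx, hIK⟩ := Finset.mem_filter.1 hI
    obtain ⟨a, ha⟩ := x.partition.nonempty_of_mem_parts hIx
    obtain ⟨J, hJ, hIJ⟩ := exists_part_superset h hIx
    have haK := hIK ha
    rw [← hK, Finset.mem_biUnion] at haK
    obtain ⟨J', hJ', haJ'⟩ := haK
    have hJJ' : J = J' :=
      y.partition.eq_of_mem_parts hJ (Finset.mem_filter.1 hJ').1 (hIJ ha) haJ'
    subst hJJ'
    exact ⟨J, hJ', Finset.mem_filter.2 ⟨hIx, hIJ⟩⟩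
  · rintro ⟨J, hJ, hI⟩
    obtain ⟨hIx, hIJ⟩ := Finset.mem_filter.1 hI
    exact Finset.mem_filter.2 ⟨hIx, hIJ.trans (Finset.mem_filter.1 hJ).2⟩

theorem parts_subset_of_le_of_le {x y : VectorPartition n s} (hxy : x ≤ y) (hyx : y ≤ x) :
    x.partition.parts ⊆ y.partition.parts := by
  intro I hI
  obtain ⟨J, hJ, hIJ⟩ := exists_part_superset hxy hI
  obtain ⟨I', hI', hJI'⟩ := exists_part_superset hyx hJ
  obtain ⟨a, ha⟩ := x.partition.nonempty_of_mem_parts hI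
  have hII' : I = I' := x.partition.eq_of_mem_parts hI hI' ha (hJI' (hIJ ha))
  have : I = J := Finset.Subset.antisymm hIJ (hII' ▸ hJI')
  exact this ▸ hJ

instance : PartialOrder (VectorPartition n s) where
  le_refl x := fun J hJ => by simp [partsIn_self x hJ]
  le_trans x y z hxy hyz := by
    intro K hK
    have hy : ∀ J ∈ y.partsIn K, J ∈ y.partition.parts := fun J hJ => (Finset.mem_filter.1 hJ).1
    rw [partsIn_eq_biUnion hxy (hyz K hK).1]
    refine ⟨?_, fun i => ?_⟩
    · rw [Finset.biUnion_biUnion]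
      conv_rhs => rw [← (hyz K hK).1]
      exact Finset.biUnion_congr rfl fun J hJ => (hxy J (hy J hJ)).1
    · rw [Finset.biUnion_biUnion, ← (hyz K hK).2 i]
      exact Finset.biUnion_congr rfl fun J hJ => (hxy J (hy J hJ)).2 i
  le_antisymm x y hxy hyx := by
    have hp : x.partition.parts = y.partition.parts :=
      Finset.Subset.antisymm (parts_subset_of_le_of_le hxy hyx) (parts_subset_of_le_of_le hyx hxy)
    refine VectorPartition.ext (Finpartition.ext hp) ?_
    funext i I
    by_cases hI : I ∈ x.partition.parts
    · have h := (hxy I (hp ▸ hI)).2 i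
      rwa [partsIn_self x hI, Finset.singleton_biUnion] at h
    · rw [x.label_of_notMem i I hI, y.label_of_notMem i I (hp ▸ hI)]

/-- The greatest element `([n], …, [n])`. -/
instance : OrderTop (VectorPartition n s) where
  top :=
    { partition := ⊤
      label := fun _ I => if I ∈ (⊤ : Finpartition (Finset.univ : Finset (Fin n))).parts
        then I else ∅
      card_label := fun i I hI => by simp [hI]
      disjoint_label := fun i I hI J hJ hIJ => by
        simpa [hI, hJ, Function.onFun] using Finpartition.disjoint _ hI hJ hIJ
      union_label := fun i => by
        ext a
        obtain ⟨J, hJ, haJ⟩ := (⊤ : Finpartition (Finset.univ : Finset (Fin n))).exists_mem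
          (Finset.mem_univ a)
        simp only [Finset.mem_biUnion, Finset.mem_univ, iff_true]
        exact ⟨J, hJ, by simpa [hJ] using haJ⟩
      label_of_notMem := fun i I hI => by simp [hI] }
  le_top x := by
    intro J hJ
    have hJu : J = Finset.univ := by
      have := Finpartition.parts_top_subset (Finset.univ : Finset (Fin n)) hJ
      simpa using this
    have hx : x.partsIn J = x.partition.parts := by
      subst hJu
      simp [partsIn]
    rw [hx]
    refine ⟨?_, fun i => ?_⟩
    · rw [hJu]
      exact x.partition.biUnion_parts
    · change _ = if _ then J else ∅
      rw [if_pos hJ, x.union_label i, hJu]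

instance : Finite (VectorPartition n s) :=
  Finite.of_injective
    (fun x : VectorPartition n s => (x.partition.parts, x.label))
    (fun x y h => by
      obtain ⟨h₁, h₂⟩ := Prod.mk.inj h
      exact VectorPartition.ext (Finpartition.ext h₁) h₂)

end VectorPartition

/-- The poset `Π_{n,s+1}`: all vector partitions of `[n]` into `s + 1` components, with a least
element `⊥` adjoined. -/
abbrev VectorPartitionPoset (n s : ℕ) : Type := WithBot (VectorPartition n s)

instance (n s : ℕ) : Finite (VectorPartitionPoset n s) :=
  inferInstanceAs (Finite (Option (VectorPartition n s)))

/-! ### EL-labelings -/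

section EL

variable {P : Type*} [PartialOrder P] {Λ : Type*}

/-- An edge labeling of `P` with values in `Λ`: a map from the edges `x ⋖ y` of `P` to `Λ`. -/
abbrev EdgeLabeling (P : Type*) [PartialOrder P] (Λ : Type*) : Type _ :=
  ∀ x y : P, x ⋖ y → Λ

/-- The maximal chains `x = x₀ ⋖ x₁ ⋖ ⋯ ⋖ x_m = y` of the interval `[x, y]` (of a finite poset). -/
inductive MaxChain : P → P → Type _
  | nil (x : P) : MaxChain x x
  | cons {x z y : P} (h : x ⋖ z) (c : MaxChain z y) : MaxChain x y

/-- The chain label `lam(x₀ ⋖ x₁) lam(x₁ ⋖ x₂) ⋯ lam(x_{m-1} ⋖ x_m)`. -/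
def MaxChain.word (lam : EdgeLabeling P Λ) : ∀ {x y : P}, MaxChain x y → List Λ
  | _, _, .nil _ => []
  | _, _, .cons h c => lam _ _ h :: c.word lam

/-- A maximal chain is increasing if its chain label is strictly increasing. -/
def MaxChain.Increasing [LinearOrder Λ] (lam : EdgeLabeling P Λ) {x y : P}
    (c : MaxChain x y) : Prop :=
  (c.word lam).Pairwise (· < ·)

/-- `lam` is an EL-labeling of the finite bounded poset `P`: each interval `[x, y]` has a unique
increasing maximal chain, and this chain lexicographically precedes (`List.Lex`) all the other
maximal chains of `[x, y]`. -/
def IsELLabeling [BoundedOrder P] [Finite P] [LinearOrder Λ] (lam : EdgeLabeling P Λ) : Prop :=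
  ∀ x y : P, x ≤ y → ∃ c : MaxChain x y, c.Increasing lam ∧
    (∀ c' : MaxChain x y, c'.Increasing lam → c' = c) ∧
    ∀ c' : MaxChain x y, c' ≠ c → List.Lex (· < ·) (c.word lam) (c'.word lam)

/-- A finite bounded poset is EL-shellable if it admits an EL-labeling. -/
def ELShellable (P : Type*) [PartialOrder P] [BoundedOrder P] [Finite P] : Prop :=
  ∃ (Λ : Type) (_ : LinearOrder Λ) (lam : EdgeLabeling P Λ), IsELLabeling lam

end EL

/-! ### The edge labeling of `Π_{n,s+1}` -/

/-- The words `w¹₁ … w¹ₙ … … wˢ₁ … wˢₙ` in the alphabet `[n]`, ordered lexicographically. -/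
abbrev AtomWord (n s : ℕ) : Type := Lex (Fin s → Lex (Fin n → Fin n))

/-- The letter `wⁱₖ` of a word. -/
def AtomWord.letter {n s : ℕ} (w : AtomWord n s) (i : Fin s) (k : Fin n) : Fin n :=
  ofLex (ofLex w i) k

namespace VectorPartition

open scoped Classical

variable {n s : ℕ}

/-- The word of an atom: its letter `wⁱₖ` is the only element of the `i`th label of the part `{k}`.
(This is used for atoms only; the second branch is a default value for vector partitions which are
not atoms.) -/
noncomputable def word (a : VectorPartition n s) : AtomWord n s :=
  toLex fun i => toLex fun k =>
    if h : (a.label i {k}).Nonempty then (a.label i {k}).min' h else k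

/-- The finite set of atoms of `Π_{n,s+1}`. -/
noncomputable def atoms (n s : ℕ) : Finset (VectorPartition n s) :=
  (Set.toFinite {a : VectorPartition n s | IsAtom (a : VectorPartitionPoset n s)}).toFinset

/-- The finite set of atoms of `Π_{n,s+1}` below `x`. -/
noncomputable def atomsBelow (x : VectorPartition n s) : Finset (VectorPartition n s) :=
  {a ∈ atoms n s | a ≤ x}

theorem atomsBelow_nonempty (x : VectorPartition n s) : x.atomsBelow.Nonempty := by
  obtain h | ⟨a, ha, hax⟩ := IsAtomic.eq_bot_or_exists_atom_le (x : VectorPartitionPoset n s)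
  · exact absurd h WithBot.coe_ne_bot
  · obtain ⟨b, rfl⟩ := WithBot.ne_bot_iff_exists.1 ha.1
    exact ⟨b, by simpa [atomsBelow, atoms] using ⟨ha, WithBot.coe_le_coe.1 hax⟩⟩

/-- The atom `A(x)` of `x`: the lexicographically first atom of `Π_{n,s+1}` below `x`, identified
with its word. -/
noncomputable def firstAtom (x : VectorPartition n s) : AtomWord n s :=
  (x.atomsBelow.image word).min' (x.atomsBelow_nonempty.image word)

/-- The position (counted from `1`) of the atom `a` in the lexicographic order of the atoms. -/
noncomputable def atomRank (a : VectorPartition n s) : ℕ :=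
  ((atoms n s).filter fun b => b.word ≤ a.word).card

/-- `max (I ∪ J)`, as an element of `{1, …, n}`, if `y` is obtained from `x` by merging the parts `I`
and `J`: these are the parts of `x` which are not parts of `y`. -/
def mergeMax (x y : VectorPartition n s) : ℕ :=
  ((x.partition.parts \ y.partition.parts).biUnion id).sup fun a => (a : ℕ) + 1

end VectorPartition

/-- The triples `(k, i, j)` such that `wⁱₖ ≠ w'ⁱₖ` and `w'ⁱₖ = j`, where `k, j` run through
`{1, …, n}` and `i` through `{1, …, s}`, in the lexicographically ordered `ℤ × ℤ × ℤ`. -/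
def changeTriples {n s : ℕ} (w w' : AtomWord n s) : Finset (ℤ ×ₗ ℤ ×ₗ ℤ) :=
  (Finset.univ.filter fun p : Fin n × Fin s => w.letter p.2 p.1 ≠ w'.letter p.2 p.1).image fun p =>
    toLex ((p.1 : ℤ) + 1, toLex ((p.2 : ℤ) + 1, ((w'.letter p.2 p.1 : Fin n) : ℤ) + 1))

theorem changeTriples_nonempty {n s : ℕ} {w w' : AtomWord n s} (h : w ≠ w') :
    (changeTriples w w').Nonempty := by
  rw [changeTriples, Finset.image_nonempty]
  by_contra hne
  rw [Finset.not_nonempty_iff_eq_empty, Finset.filter_eq_empty_iff] at hne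
  refine h (funext fun i => funext fun k => ?_)
  exact not_not.1 (hne (Finset.mem_univ (k, i)))

/-- The edge labeling of `Π_{n,s+1}` with values in `ℤ × ℤ × ℤ`, ordered lexicographically. -/
noncomputable def vectorPartitionLabeling (n s : ℕ) :
    EdgeLabeling (VectorPartitionPoset n s) (ℤ ×ₗ ℤ ×ₗ ℤ) := fun x y hxy =>
  match x, y, hxy with
  | (x : VectorPartition n s), (y : VectorPartition n s), _ =>
      if h : x.firstAtom = y.firstAtom then toLex ((n : ℤ), toLex ((x.mergeMax y : ℤ), 0))
      else (changeTriples x.firstAtom y.firstAtom).min' (changeTriples_nonempty h)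
  | ⊥, (a : VectorPartition n s), _ =>
      toLex ((n : ℤ) - 1, toLex ((s : ℤ) + a.atomRank, 0))
  | _, ⊥, h => (not_lt_bot h.lt).elim

/-! ### A local criterion for EL-labelings -/

section EL

variable {P : Type*} [PartialOrder P] {Λ : Type*}

/-! By the local criterion `isELLabeling_of_exists_covBy`, it is enough to find, for all `x < y`, an
edge `x ⋖ z` in `[x, y]` with the strictly smallest label, such that labels leaving `z` are larger
and every other first edge can be followed by one whose label is not larger.

The first atom below `x` is obtained by sorting each label along its part (`firstAtom_eq_word`).
Above `x` an element is determined by its underlying partition (`le_of_rel`), and covers merge two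
parts (`eq_merge_of_covBy`).

If `A(x) ≠ A(y)`, let `(k, i)` be the first place of difference and `j` the letter of `y` there.
Every element of `[x, y]` agrees with `y` before `(k, i)`, and has the letter `j` at `(k, i)` iff it
joins `k` to the position `b > k` of `j` in the word of `x` (`FirstDiff.exists_rel`). Merging these
two parts is the unique edge from `x` with the least label `(k, i, j)`. This merge remains available
until it is performed, and later labels are larger.

If `A(x) = A(y)`, then `A` is constant on `[x, y]`, and the label `(n, max (I ∪ J), 0)` behaves as
the classical labeling of the partition lattice: only the smaller of two part maxima disappears in a
merge, and the least edge is the one with the least larger maximum.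

At `⊥` the least edge leads to the atom `A(y)`, from which all labels in `[A(y), y]` begin with `n`.
From any other atom there is an edge of the first kind, whose label is below `(n - 1, s + m, 0)`
since `k ≤ n - 1` and `i ≤ s`. -/

theorem MaxChain.le {x y : P} (c : MaxChain x y) : x ≤ y := by
  induction c with
  | nil => exact le_rfl
  | cons h _ ih => exact h.le.trans ih

theorem MaxChain.eq_nil {x : P} (c : MaxChain x x) : c = .nil x := by
  cases c with
  | nil => rfl
  | cons h c => exact absurd h.lt c.le.not_gt

/-- A local criterion for EL-labelings: above each `x < y` there is an edge `x ⋖ z` in `[x, y]`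
with the strictly smallest label, all labels of edges of `[z, y]` starting at `z` are larger, and
any other edge `x ⋖ z'` of `[x, y]` can be followed by one whose label is not larger. -/
theorem isELLabeling_of_exists_covBy [BoundedOrder P] [Finite P] [LinearOrder Λ]
    (lam : EdgeLabeling P Λ)
    (H : ∀ x y : P, x < y → ∃ (z : P) (hz : x ⋖ z), z ≤ y ∧
      (∀ (z' : P) (hz' : x ⋖ z'), z' ≤ y → z' ≠ z → lam x z hz < lam x z' hz' ∧
        ∃ (u : P) (hu : z' ⋖ u), u ≤ y ∧ lam z' u hu ≤ lam x z' hz') ∧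
      ∀ (u : P) (hu : z ⋖ u), u ≤ y → lam x z hz < lam z u hu) :
    IsELLabeling lam := by
  -- The increasing chain is moreover required to start with the smallest label.
  suffices h : ∀ x y : P, x ≤ y → ∃ c : MaxChain x y, c.Increasing lam ∧
      (∀ c' : MaxChain x y, c'.Increasing lam → c' = c) ∧
      (∀ c' : MaxChain x y, c' ≠ c → List.Lex (· < ·) (c.word lam) (c'.word lam)) ∧
      ∀ (z : P) (hz : x ⋖ z), z ≤ y → ∀ l ∈ (c.word lam).head?, l ≤ lam x z hz by
    intro x y hxy
    obtain ⟨c, h₁, h₂, h₃, -⟩ := h x y hxy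
    exact ⟨c, h₁, h₂, h₃⟩
  intro x y
  induction x using (Finite.to_wellFoundedGT (α := P)).induction with
  | _ x ih =>
  intro hxy
  obtain rfl | hlt := hxy.eq_or_lt
  · refine ⟨.nil x, List.Pairwise.nil, fun c' _ => c'.eq_nil, fun c' hc' => absurd c'.eq_nil hc', ?_⟩
    simp [MaxChain.word]
  obtain ⟨z, hz, hzy, hother, hnext⟩ := H x y hlt
  obtain ⟨c, hc, huniq, hlex, hhead⟩ := ih z hz.lt hzy
  have hmin : ∀ (z' : P) (hz' : x ⋖ z'), z' ≤ y → lam x z hz ≤ lam x z' hz' := by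
    intro z' hz' hz'y
    by_cases h : z' = z
    · subst h; exact le_rfl
    · exact (hother z' hz' hz'y h).1.le
  refine ⟨.cons hz c, ?_, ?_, ?_, ?_⟩
  · refine List.isChain_iff_pairwise.1 ?_
    have hc' := List.isChain_iff_pairwise.2 hc
    cases c with
    | nil => simp [MaxChain.word]
    | cons h c => exact List.IsChain.cons_cons (hnext _ h c.le) hc'
  · intro c' hc'
    cases c' with
    | nil => exact absurd hlt (lt_irrefl _)
    | @cons _ z' _ hz' c' =>
      have hinc : c'.Increasing lam := (List.pairwise_cons.1 hc').2
      by_cases h : z' = z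
      · subst h
        rw [huniq c' hinc]
      · exfalso
        -- If `c'` increases, it is the distinguished chain of `[z', y]`, so its first label is at
        -- most that of `z' ⋖ u`, hence at most that of `x ⋖ z'`: the chain does not increase at
        -- `z'`.
        obtain ⟨-, u, hu, huy, hle⟩ := hother z' hz' c'.le h
        obtain ⟨d, -, hd, -, hdhead⟩ := ih z' hz'.lt c'.le
        have hdc := hd c' hinc
        cases c' with
        | nil => exact absurd huy hu.lt.not_ge
        | cons h' c' =>
          have h₁ := hdhead u hu huy (lam _ _ h') (by rw [← hdc]; simp [MaxChain.word])
          have h₂ : lam x z' hz' < lam _ _ h' :=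
            (List.pairwise_cons.1 hc').1 _ (by simp [MaxChain.word])
          exact absurd (h₁.trans hle) h₂.not_ge
  · intro c' hc'
    cases c' with
    | nil => exact absurd hlt (lt_irrefl _)
    | @cons _ z' _ hz' c' =>
      by_cases h : z' = z
      · subst h
        exact List.Lex.cons (hlex c' fun h => hc' (by rw [h]))
      · exact List.Lex.rel (hother z' hz' c'.le h).1
  · intro z' hz' hz'y l hl
    simp only [MaxChain.word, List.head?_cons, Option.mem_def, Option.some.injEq] at hl
    exact hl ▸ hmin z' hz' hz'y

end EL

namespace VectorPartition

open Finset

variable {n s : ℕ}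

/-! ### Elementwise description of vector partitions -/

/-- Two elements of `[n]` are related if they lie in the same part. -/
def Rel (x : VectorPartition n s) (a b : Fin n) : Prop :=
  x.partition.part a = x.partition.part b

theorem Rel.refl (x : VectorPartition n s) (a : Fin n) : x.Rel a a := rfl

theorem Rel.symm {x : VectorPartition n s} {a b : Fin n} (h : x.Rel a b) : x.Rel b a :=
  Eq.symm h

theorem Rel.trans {x : VectorPartition n s} {a b c : Fin n} (h : x.Rel a b) (h' : x.Rel b c) :
    x.Rel a c :=
  Eq.trans h h'

theorem part_mem_parts (x : VectorPartition n s) (a : Fin n) :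
    x.partition.part a ∈ x.partition.parts :=
  x.partition.part_mem.2 (mem_univ a)

theorem mem_part_self (x : VectorPartition n s) (a : Fin n) : a ∈ x.partition.part a :=
  x.partition.mem_part_self.2 (mem_univ a)

theorem mem_part_iff_rel {x : VectorPartition n s} {a b : Fin n} :
    b ∈ x.partition.part a ↔ x.Rel a b :=
  (x.partition.mem_part_iff_part_eq_part (mem_univ b) (mem_univ a)).trans eq_comm

theorem exists_eq_part {x : VectorPartition n s} {I : Finset (Fin n)}
    (hI : I ∈ x.partition.parts) : ∃ a, x.partition.part a = I := by
  obtain ⟨a, ha⟩ := x.partition.nonempty_of_mem_parts hI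
  exact ⟨a, x.partition.part_eq_of_mem hI ha⟩

theorem rel_of_mem_label {x : VectorPartition n s} {i : Fin s} {a b c : Fin n}
    (ha : c ∈ x.label i (x.partition.part a)) (hb : c ∈ x.label i (x.partition.part b)) :
    x.Rel a b := by
  by_contra h
  exact disjoint_left.1 (x.disjoint_label i _ (x.part_mem_parts a) _ (x.part_mem_parts b) h) ha hb

theorem exists_mem_label (x : VectorPartition n s) (i : Fin s) (c : Fin n) :
    ∃ a, c ∈ x.label i (x.partition.part a) := by
  have h := mem_univ c
  rw [← x.union_label i, mem_biUnion] at h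
  obtain ⟨I, hI, hc⟩ := h
  obtain ⟨a, rfl⟩ := exists_eq_part hI
  exact ⟨a, hc⟩

/-- Inclusions of labels suffice: the labels of `x` cover `[n]`, and an element of a label of `y`
lies in a label of `x` whose part is forced into the right part of `y` by disjointness. -/
theorem le_iff_label_subset {x y : VectorPartition n s} :
    x ≤ y ↔ (∀ a b, x.Rel a b → y.Rel a b) ∧
      ∀ i a, x.label i (x.partition.part a) ⊆ y.label i (y.partition.part a) := by
  constructor
  · intro h
    have hsub : ∀ a, x.partition.part a ⊆ y.partition.part a := by
      intro a
      obtain ⟨J, hJ, haJ⟩ := exists_part_superset h (x.part_mem_parts a)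
      rwa [y.partition.part_eq_of_mem hJ (haJ (x.mem_part_self a))]
    refine ⟨fun a b hab => mem_part_iff_rel.1 (hsub a (mem_part_iff_rel.2 hab)), fun i a => ?_⟩
    rw [← (h _ (y.part_mem_parts a)).2 i]
    exact subset_biUnion_of_mem (x.label i) (mem_filter.2 ⟨x.part_mem_parts a, hsub a⟩)
  · rintro ⟨hrel, hlab⟩ J hJ
    obtain ⟨d, rfl⟩ := exists_eq_part hJ
    have hin : ∀ a, y.Rel d a → x.partition.part a ∈ x.partsIn (y.partition.part d) := by
      intro a ha
      refine mem_filter.2 ⟨x.part_mem_parts a, fun b hb => ?_⟩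
      exact mem_part_iff_rel.2 (ha.trans (hrel a b (mem_part_iff_rel.1 hb)))
    refine ⟨?_, fun i => ?_⟩
    · refine Subset.antisymm ?_ fun a ha => ?_
      · exact biUnion_subset.2 fun I hI => (mem_filter.1 hI).2
      · exact mem_biUnion.2 ⟨_, hin a (mem_part_iff_rel.1 ha), x.mem_part_self a⟩
    · refine Subset.antisymm (biUnion_subset.2 fun I hI => ?_) fun c hc => ?_
      · obtain ⟨hI, hId⟩ := mem_filter.1 hI
        obtain ⟨a, rfl⟩ := exists_eq_part hI
        have hda : y.partition.part d = y.partition.part a :=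
          mem_part_iff_rel.1 (hId (x.mem_part_self a))
        rw [hda]
        exact hlab i a
      · obtain ⟨a, ha⟩ := x.exists_mem_label i c
        exact mem_biUnion.2 ⟨_, hin a (rel_of_mem_label hc (hlab i a ha)), ha⟩

/-- The vector partition with underlying partition `P` whose `i`th label of a part is its image
under the permutation `V i`. -/
def ofPerm (P : Finpartition (univ : Finset (Fin n))) (V : Fin s → Equiv.Perm (Fin n)) :
    VectorPartition n s where
  partition := P
  label i I := if I ∈ P.parts then I.map (V i).toEmbedding else ∅
  card_label i I hI := by simp [hI]
  disjoint_label i I hI J hJ hIJ := by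
    simpa [hI, hJ, Function.onFun] using P.disjoint hI hJ hIJ
  union_label i := by
    ext c
    obtain ⟨J, hJ, hcJ⟩ := P.exists_mem (mem_univ ((V i).symm c))
    simp only [mem_biUnion, mem_univ, iff_true]
    exact ⟨J, hJ, by simpa [hJ, mem_map_equiv] using hcJ⟩
  label_of_notMem i I hI := by simp [hI]

theorem mem_label_ofPerm {P : Finpartition (univ : Finset (Fin n))}
    {V : Fin s → Equiv.Perm (Fin n)} {i : Fin s} {a c : Fin n} :
    V i c ∈ (ofPerm P V).label i ((ofPerm P V).partition.part a) ↔ (ofPerm P V).Rel a c := by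
  have h : (ofPerm P V).partition.part a ∈ P.parts := part_mem_parts _ a
  rw [← mem_part_iff_rel]
  change _ ∈ (if _ then _ else _) ↔ _
  rw [if_pos h, mem_map_equiv, Equiv.symm_apply_apply]

/-! ### The first atom below a vector partition -/

theorem exists_strictMonoOn_image_eq {S T : Finset (Fin n)} (h : T.card = S.card) :
    ∃ f : Fin n → Fin n, StrictMonoOn f S ∧ S.image f = T := by
  let e : S ≃o T := (S.orderIsoOfFin rfl).symm.trans (T.orderIsoOfFin h)
  refine ⟨fun a => if ha : a ∈ S then e ⟨a, ha⟩ else a, ?_, ?_⟩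
  · intro a ha b hb hab
    simp only [mem_coe] at ha hb
    simpa [ha, hb] using hab
  · ext c
    simp only [mem_image]
    constructor
    · rintro ⟨a, ha, rfl⟩
      simp [ha]
    · intro hc
      refine ⟨e.symm ⟨c, hc⟩, (e.symm ⟨c, hc⟩).2, by simp⟩

/-- The labels of a vector partition are the images of its parts under permutations which are
increasing on the parts. -/
theorem exists_sorted_perm (x : VectorPartition n s) :
    ∃ V : Fin s → Equiv.Perm (Fin n), (∀ i a b, x.Rel a b → a < b → V i a < V i b) ∧
      ∀ i a c, V i c ∈ x.label i (x.partition.part a) ↔ x.Rel a c := by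
  have h : ∀ (i : Fin s) (I : Finset (Fin n)), ∃ f : Fin n → Fin n,
      I ∈ x.partition.parts → StrictMonoOn f I ∧ I.image f = x.label i I := by
    intro i I
    by_cases hI : I ∈ x.partition.parts
    · obtain ⟨f, hf⟩ := exists_strictMonoOn_image_eq (x.card_label i I hI)
      exact ⟨f, fun _ => hf⟩
    · exact ⟨id, fun h => absurd h hI⟩
  choose f hf using h
  have hmono : ∀ i a b, x.Rel a b → a < b →
      f i (x.partition.part a) a < f i (x.partition.part b) b := by
    intro i a b hab hlt
    have h := (hf i _ (x.part_mem_parts a)).1 (mem_coe.2 (x.mem_part_self a))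
      (mem_coe.2 (mem_part_iff_rel.2 hab)) hlt
    rwa [← show x.partition.part a = x.partition.part b from hab]
  have hmem : ∀ i a, f i (x.partition.part a) a ∈ x.label i (x.partition.part a) := by
    intro i a
    rw [← (hf i _ (x.part_mem_parts a)).2]
    exact mem_image_of_mem _ (x.mem_part_self a)
  -- Equal values lie in one label, hence come from one part, where `f` is strictly increasing.
  have hinj : ∀ i, Function.Injective fun a => f i (x.partition.part a) a := by
    intro i a b hab
    have hr : x.Rel a b := by
      refine rel_of_mem_label (hmem i a) ?_
      simp only at hab
      rw [hab]
      exact hmem i b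
    rcases lt_trichotomy a b with hlt | heq | hlt
    · exact absurd hab (hmono i a b hr hlt).ne
    · exact heq
    · exact absurd hab (hmono i b a hr.symm hlt).ne'
  refine ⟨fun i => Equiv.ofBijective _ (Finite.injective_iff_bijective.1 (hinj i)), hmono,
    fun i a c => ⟨fun h => rel_of_mem_label h (hmem i c), fun h => ?_⟩⟩
  rw [show x.partition.part a = x.partition.part c from h]
  exact hmem i c

theorem rel_ofPerm_bot {V : Fin s → Equiv.Perm (Fin n)} {a b : Fin n} :
    (ofPerm ⊥ V).Rel a b ↔ a = b := by
  have h : ∀ c, (⊥ : Finpartition (univ : Finset (Fin n))).part c = {c} := fun c =>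
    Finpartition.part_eq_of_mem _ (by simp) (by simp)
  change Finpartition.part ⊥ a = Finpartition.part ⊥ b ↔ a = b
  rw [h, h, singleton_inj]

theorem label_ofPerm_bot {V : Fin s → Equiv.Perm (Fin n)} {i : Fin s} {a : Fin n} :
    (ofPerm ⊥ V).label i ((ofPerm ⊥ V).partition.part a) = {V i a} := by
  ext c
  obtain ⟨d, rfl⟩ := (V i).surjective c
  rw [mem_label_ofPerm, rel_ofPerm_bot, mem_singleton, (V i).injective.eq_iff, eq_comm]

theorem letter_word_ofPerm_bot {V : Fin s → Equiv.Perm (Fin n)} {i : Fin s} {k : Fin n} :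
    (ofPerm ⊥ V).word.letter i k = V i k := by
  have h : (ofPerm ⊥ V).label i {k} = {V i k} := by
    rw [← label_ofPerm_bot (V := V)]
    congr 1
    exact (Finpartition.part_eq_of_mem _ (by simp [ofPerm]) (by simp)).symm
  simp [word, AtomWord.letter, h]

theorem ofPerm_bot_le_iff {V : Fin s → Equiv.Perm (Fin n)} {x : VectorPartition n s} :
    ofPerm ⊥ V ≤ x ↔ ∀ i a, V i a ∈ x.label i (x.partition.part a) := by
  rw [le_iff_label_subset]
  simp only [label_ofPerm_bot, singleton_subset_iff, rel_ofPerm_bot, and_iff_right_iff_imp]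
  rintro - a b rfl
  exact Rel.refl x a

theorem exists_ofPerm_bot_le (x : VectorPartition n s) :
    ∃ V : Fin s → Equiv.Perm (Fin n), ofPerm ⊥ V ≤ x := by
  obtain ⟨V, -, hV⟩ := x.exists_sorted_perm
  exact ⟨V, ofPerm_bot_le_iff.2 fun i a => (hV i a a).2 (Rel.refl x a)⟩

/-- Anything below has some `ofPerm ⊥ V'` below it, and inclusion between singleton labels forces
`V' = V`. -/
theorem isMin_ofPerm_bot (V : Fin s → Equiv.Perm (Fin n)) : IsMin (ofPerm ⊥ V) := by
  intro u hu
  obtain ⟨V', hV'⟩ := u.exists_ofPerm_bot_le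
  have h : V' = V := by
    funext i
    ext1 a
    have := (le_iff_label_subset.1 (hV'.trans hu)).2 i a
    simpa [label_ofPerm_bot] using this
  exact h ▸ hV'

theorem isMin_iff_exists_eq_ofPerm {a : VectorPartition n s} :
    IsMin a ↔ ∃ V, a = ofPerm ⊥ V := by
  constructor
  · intro h
    obtain ⟨V, hV⟩ := a.exists_ofPerm_bot_le
    exact ⟨V, le_antisymm (h hV) hV⟩
  · rintro ⟨V, rfl⟩
    exact isMin_ofPerm_bot V

theorem mem_atoms_iff {a : VectorPartition n s} : a ∈ atoms n s ↔ IsMin a := by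
  rw [atoms, Set.Finite.mem_toFinset, Set.mem_ofPred_eq, ← bot_covBy_iff, WithBot.bot_covBy_coe]

theorem mem_atomsBelow_iff {a x : VectorPartition n s} :
    a ∈ x.atomsBelow ↔ IsMin a ∧ a ≤ x := by
  simp [atomsBelow, mem_atoms_iff]

/-- The `k`th letter of the `i`th component of the first atom below `x`. -/
noncomputable def letter (x : VectorPartition n s) (i : Fin s) (k : Fin n) : Fin n :=
  x.firstAtom.letter i k

theorem firstAtom_eq_iff {x y : VectorPartition n s} :
    x.firstAtom = y.firstAtom ↔ ∀ i k, x.letter i k = y.letter i k :=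
  ⟨fun h i k => by rw [letter, letter, h], fun h => funext fun i => funext fun k => h i k⟩

/-- At the first letter where `V'` falls below `V`, the letter of `V'` is `V i c` with `c` in the
part of `k`. If `c < k`, then `V'` has used it already; if `c ≥ k`, it is not smaller, as `V`
increases on the part. -/
theorem word_ofPerm_bot_le {x : VectorPartition n s} {V V' : Fin s → Equiv.Perm (Fin n)}
    (hmono : ∀ i a b, x.Rel a b → a < b → V i a < V i b)
    (hV : ∀ i a c, V i c ∈ x.label i (x.partition.part a) ↔ x.Rel a c)
    (hV' : ofPerm ⊥ V' ≤ x) : (ofPerm ⊥ V).word ≤ (ofPerm ⊥ V').word := by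
  rw [← not_lt]
  rintro ⟨i, -, k, hk, hlt⟩
  change ∀ j < k, (ofPerm ⊥ V').word.letter i j = (ofPerm ⊥ V).word.letter i j at hk
  change (ofPerm ⊥ V').word.letter i k < (ofPerm ⊥ V).word.letter i k at hlt
  simp only [letter_word_ofPerm_bot] at hk hlt
  obtain ⟨c, hc⟩ := (V i).surjective (V' i k)
  have hkc : x.Rel k c := (hV i k c).1 (hc ▸ ofPerm_bot_le_iff.1 hV' i k)
  rcases lt_trichotomy c k with h | h | h
  · exact h.ne ((V' i).injective ((hk c h).trans hc))
  · rw [← hc, h] at hlt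
    exact lt_irrefl _ hlt
  · rw [← hc] at hlt
    exact absurd (hmono i k c hkc h) hlt.not_gt

theorem firstAtom_eq_word {x : VectorPartition n s} {V : Fin s → Equiv.Perm (Fin n)}
    (hmono : ∀ i a b, x.Rel a b → a < b → V i a < V i b)
    (hV : ∀ i a c, V i c ∈ x.label i (x.partition.part a) ↔ x.Rel a c) :
    x.firstAtom = (ofPerm ⊥ V).word := by
  refine le_antisymm (min'_le _ _ (mem_image_of_mem _ ?_)) (le_min' _ _ _ ?_)
  · exact mem_atomsBelow_iff.2 ⟨isMin_ofPerm_bot V,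
      ofPerm_bot_le_iff.2 fun i a => (hV i a a).2 (Rel.refl x a)⟩
  · intro w hw
    obtain ⟨a, ha, rfl⟩ := mem_image.1 hw
    obtain ⟨ha, hax⟩ := mem_atomsBelow_iff.1 ha
    obtain ⟨V', rfl⟩ := isMin_iff_exists_eq_ofPerm.1 ha
    exact word_ofPerm_bot_le hmono hV hax

theorem exists_perm_eq_letter (x : VectorPartition n s) :
    ∃ V : Fin s → Equiv.Perm (Fin n), (∀ i k, V i k = x.letter i k) ∧
      (∀ i a b, x.Rel a b → a < b → V i a < V i b) ∧
      ∀ i a c, V i c ∈ x.label i (x.partition.part a) ↔ x.Rel a c := by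
  obtain ⟨V, hmono, hV⟩ := x.exists_sorted_perm
  refine ⟨V, fun i k => ?_, hmono, hV⟩
  rw [letter, firstAtom_eq_word hmono hV, letter_word_ofPerm_bot]

theorem letter_bijective (x : VectorPartition n s) (i : Fin s) :
    Function.Bijective (x.letter i) := by
  obtain ⟨V, hV, -⟩ := x.exists_perm_eq_letter
  rw [← funext (hV i)]
  exact (V i).bijective

theorem letter_lt {x : VectorPartition n s} {i : Fin s} {a b : Fin n} (h : x.Rel a b)
    (hab : a < b) : x.letter i a < x.letter i b := by
  obtain ⟨V, hV, hmono, -⟩ := x.exists_perm_eq_letter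
  rw [← hV, ← hV]
  exact hmono i a b h hab

theorem letter_le {x : VectorPartition n s} {i : Fin s} {a b : Fin n} (h : x.Rel a b)
    (hab : a ≤ b) : x.letter i a ≤ x.letter i b := by
  obtain rfl | hlt := hab.eq_or_lt
  · exact le_rfl
  · exact (letter_lt h hlt).le

theorem letter_mem_label {x : VectorPartition n s} {i : Fin s} {a c : Fin n} :
    x.letter i c ∈ x.label i (x.partition.part a) ↔ x.Rel a c := by
  obtain ⟨V, hV, -, h⟩ := x.exists_perm_eq_letter
  rw [← hV, h]

/-- In terms of words: passing from `x` up to `y` moves a letter only within a part of `y`. -/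
theorem le_iff {x y : VectorPartition n s} : x ≤ y ↔ (∀ a b, x.Rel a b → y.Rel a b) ∧
    ∀ i a c, x.letter i a = y.letter i c → y.Rel a c := by
  rw [le_iff_label_subset]
  refine and_congr_right fun hrel => ⟨fun h i a c hac => ?_, fun h i a c hc => ?_⟩
  · have := h i a (letter_mem_label.2 (Rel.refl x a))
    rwa [hac, letter_mem_label] at this
  · obtain ⟨b, rfl⟩ := (x.letter_bijective i).2 c
    obtain ⟨d, hd⟩ := (y.letter_bijective i).2 (x.letter i b)
    rw [← hd, letter_mem_label]
    exact (hrel a b (letter_mem_label.1 hc)).trans (h i b d hd.symm)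

theorem rel_of_le {x y : VectorPartition n s} (h : x ≤ y) {a b : Fin n} (hab : x.Rel a b) :
    y.Rel a b :=
  (le_iff.1 h).1 a b hab

theorem rel_of_letter_eq {x y : VectorPartition n s} (h : x ≤ y) {i : Fin s} {a c : Fin n}
    (hac : x.letter i a = y.letter i c) : y.Rel a c :=
  (le_iff.1 h).2 i a c hac

/-- Above `x`, vector partitions are compared by their underlying partitions. -/
theorem le_of_rel {x y z : VectorPartition n s} (hxy : x ≤ y) (hxz : x ≤ z)
    (h : ∀ a b, y.Rel a b → z.Rel a b) : y ≤ z := by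
  refine le_iff.2 ⟨h, fun i a c hac => ?_⟩
  obtain ⟨b, hb⟩ := (x.letter_bijective i).2 (y.letter i a)
  exact (h b a (rel_of_letter_eq hxy hb)).symm.trans (rel_of_letter_eq hxz (hb.trans hac))

end VectorPartition

namespace VectorPartition

open Finset

variable {n s : ℕ}

/-! ### Merging two parts -/

/-- The equivalence relation obtained from `x` by merging the parts of `a` and `b`. -/
def mergeSetoid (x : VectorPartition n s) (a b : Fin n) : Setoid (Fin n) where
  r c d := x.Rel c d ∨ (x.Rel a c ∨ x.Rel b c) ∧ (x.Rel a d ∨ x.Rel b d)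
  iseqv := by
    refine ⟨fun c => Or.inl rfl, ?_, ?_⟩
    · intro c d
      simp only [Rel]
      grind
    · intro c d e
      simp only [Rel]
      grind

open scoped Classical in
/-- The vector partition obtained from `x` by merging the parts of `a` and `b`. -/
noncomputable def merge (x : VectorPartition n s) (a b : Fin n) : VectorPartition n s :=
  ofPerm (Finpartition.ofSetoid (x.mergeSetoid a b))
    -- These permutations need not increase on the merged part; only the images of the parts matter.
    fun i => Equiv.ofBijective (x.letter i) (x.letter_bijective i)

theorem rel_merge {x : VectorPartition n s} {a b c d : Fin n} : (x.merge a b).Rel c d ↔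
    x.Rel c d ∨ (x.Rel a c ∨ x.Rel b c) ∧ (x.Rel a d ∨ x.Rel b d) := by
  classical
  rw [← mem_part_iff_rel]
  exact Finpartition.mem_part_ofSetoid_iff_rel

theorem rel_merge_self (x : VectorPartition n s) (a b : Fin n) : (x.merge a b).Rel a b :=
  rel_merge.2 (Or.inr ⟨Or.inl (Rel.refl x a), Or.inr (Rel.refl x b)⟩)

theorem le_merge (x : VectorPartition n s) (a b : Fin n) : x ≤ x.merge a b := by
  have h : ∀ c d, x.Rel c d → (x.merge a b).Rel c d := fun c d hcd => rel_merge.2 (Or.inl hcd)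
  refine le_iff_label_subset.2 ⟨h, fun i c e he => ?_⟩
  obtain ⟨d, rfl⟩ := (x.letter_bijective i).2 e
  exact mem_label_ofPerm.2 (h c d (letter_mem_label.1 he))

theorem merge_le {x y : VectorPartition n s} (hxy : x ≤ y) {a b : Fin n} (hab : y.Rel a b) :
    x.merge a b ≤ y := by
  refine le_of_rel (x.le_merge a b) hxy fun c d hcd => ?_
  rcases rel_merge.1 hcd with h | ⟨h | h, h' | h'⟩
  · exact rel_of_le hxy h
  · exact rel_of_le hxy (h.symm.trans h')
  · exact (rel_of_le hxy h.symm).trans (hab.trans (rel_of_le hxy h'))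
  · exact (rel_of_le hxy h.symm).trans (hab.symm.trans (rel_of_le hxy h'))
  · exact rel_of_le hxy (h.symm.trans h')

theorem exists_rel_of_lt {x y : VectorPartition n s} (h : x < y) :
    ∃ a b, y.Rel a b ∧ ¬ x.Rel a b := by
  by_contra! hc
  exact h.not_ge (le_of_rel h.le le_rfl hc)

theorem covBy_merge {x : VectorPartition n s} {a b : Fin n} (hab : ¬ x.Rel a b) :
    x ⋖ x.merge a b := by
  refine ⟨lt_of_le_of_ne (x.le_merge a b) fun h => hab (h ▸ x.rel_merge_self a b),
    fun u hxu hu => hu.not_ge (merge_le hxu.le ?_)⟩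
  obtain ⟨c, d, hcd, hncd⟩ := exists_rel_of_lt hxu
  rcases rel_merge.1 (rel_of_le hu.le hcd) with h | ⟨h | h, h' | h'⟩
  · exact absurd h hncd
  · exact absurd (h.symm.trans h') hncd
  · exact (rel_of_le hxu.le h).trans (hcd.trans (rel_of_le hxu.le h'.symm))
  · exact (rel_of_le hxu.le h').trans (hcd.symm.trans (rel_of_le hxu.le h.symm))
  · exact absurd (h.symm.trans h') hncd

theorem eq_merge_of_covBy {x z : VectorPartition n s} (h : x ⋖ z) {a b : Fin n}
    (hz : z.Rel a b) (hx : ¬ x.Rel a b) : z = x.merge a b :=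
  ((h.eq_or_eq (x.le_merge a b) (merge_le h.le hz)).resolve_left (covBy_merge hx).ne').symm

/-! ### Comparison of letters -/

/-- If the earlier letters agree, then the first atom below the larger element has the smaller
letter. -/
theorem letter_le_letter_of_le {x y : VectorPartition n s} (h : x ≤ y) {i : Fin s} {k : Fin n}
    (hk : ∀ a < k, x.letter i a = y.letter i a) : y.letter i k ≤ x.letter i k := by
  obtain ⟨c, hc⟩ := (y.letter_bijective i).2 (x.letter i k)
  have hkc : y.Rel k c := rel_of_letter_eq h hc.symm
  rcases lt_or_ge c k with hlt | hle
  · exact absurd ((x.letter_bijective i).1 ((hk c hlt).trans hc)) hlt.ne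
  · exact hc ▸ letter_le hkc hle

/-- `letter_le_letter_of_le`, applied to `x ≤ z` and to `z ≤ y`, squeezes the letter of `z` once the
preceding letters agree. -/
theorem letter_eq_of_le_of_le {x y z : VectorPartition n s} (hxz : x ≤ z) (hzy : z ≤ y)
    {i : Fin s} {k : Fin n} (hk : ∀ a ≤ k, x.letter i a = y.letter i a) :
    z.letter i k = y.letter i k := by
  induction k using WellFoundedLT.induction with
  | _ k ih =>
  have hz : ∀ a < k, z.letter i a = y.letter i a := fun a ha =>
    ih a ha fun b hb => hk b (hb.trans ha.le)
  refine le_antisymm ?_ (letter_le_letter_of_le hzy hz)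
  rw [← hk k le_rfl]
  exact letter_le_letter_of_le hxz fun a ha => (hk a ha.le).trans (hz a ha).symm

theorem firstAtom_eq_of_le_of_le {x y z : VectorPartition n s} (hxz : x ≤ z) (hzy : z ≤ y)
    (h : x.firstAtom = y.firstAtom) : z.firstAtom = y.firstAtom :=
  firstAtom_eq_iff.2 fun i _ =>
    letter_eq_of_le_of_le hxz hzy fun a _ => firstAtom_eq_iff.1 h i a

/-- `(k, i)` is the first pair, in the lexicographic order, for which the `k`th letters of the
`i`th components of the first atoms below `x` and `y` differ. -/
def FirstDiff (x y : VectorPartition n s) (k : Fin n) (i : Fin s) : Prop :=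
  x.letter i k ≠ y.letter i k ∧
    ∀ k' i', k' < k ∨ k' = k ∧ i' < i → x.letter i' k' = y.letter i' k'

theorem exists_firstDiff {x y : VectorPartition n s} (h : x.firstAtom ≠ y.firstAtom) :
    ∃ k i, FirstDiff x y k i := by
  have hne : ∃ k i, x.letter i k ≠ y.letter i k := by
    by_contra! hc
    exact h (firstAtom_eq_iff.2 fun i k => hc k i)
  obtain ⟨k, ⟨i₀, hi₀⟩, hk⟩ :=
    wellFounded_lt.has_min {k : Fin n | ∃ i, x.letter i k ≠ y.letter i k} hne
  obtain ⟨i, hi, hmin⟩ :=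
    wellFounded_lt.has_min {i : Fin s | x.letter i k ≠ y.letter i k} ⟨i₀, hi₀⟩
  refine ⟨k, i, hi, ?_⟩
  rintro k' i' (hlt | ⟨rfl, hlt⟩)
  · by_contra hc
    exact hk k' ⟨i', hc⟩ hlt
  · by_contra hc
    exact hmin i' hc hlt

/-- The squeeze needs agreement on a whole prefix of the component `i'`; all places of that prefix
also precede `(k, i)`. -/
theorem FirstDiff.letter_eq {x y z : VectorPartition n s} {k : Fin n} {i : Fin s}
    (h : FirstDiff x y k i) (hxz : x ≤ z) (hzy : z ≤ y) {k' : Fin n} {i' : Fin s}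
    (hlt : k' < k ∨ k' = k ∧ i' < i) : z.letter i' k' = y.letter i' k' := by
  refine letter_eq_of_le_of_le hxz hzy fun a ha => h.2 a i' ?_
  rcases hlt with hlt | ⟨rfl, hlt⟩
  · exact Or.inl (ha.trans_lt hlt)
  · exact ha.lt_or_eq.imp_right fun h => ⟨h, hlt⟩

theorem FirstDiff.of_le {x y z : VectorPartition n s} {k : Fin n} {i : Fin s}
    (h : FirstDiff x y k i) (hxz : x ≤ z) (hzy : z ≤ y) (hz : z.letter i k ≠ y.letter i k) :
    FirstDiff z y k i :=
  ⟨hz, fun _ _ hlt => h.letter_eq hxz hzy hlt⟩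

theorem FirstDiff.letter_le {x y z : VectorPartition n s} {k : Fin n} {i : Fin s}
    (h : FirstDiff x y k i) (hxz : x ≤ z) (hzy : z ≤ y) : y.letter i k ≤ z.letter i k :=
  letter_le_letter_of_le hzy fun _ ha => h.letter_eq hxz hzy (Or.inl ha)

/-- At the first difference, the letter of `y` is attained in `[x, y]` exactly by the elements
in which the part of `k` is merged with the part of a certain larger element `b`. -/
theorem FirstDiff.exists_rel {x y : VectorPartition n s} {k : Fin n} {i : Fin s}
    (h : FirstDiff x y k i) (hxy : x ≤ y) : ∃ b, k < b ∧ ¬ x.Rel k b ∧ y.Rel k b ∧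
      ∀ z, x ≤ z → z ≤ y → (z.letter i k = y.letter i k ↔ z.Rel k b) := by
  -- `b` is where the word of `x` has the letter that `y` has at `k`. If `b < k`, agreement before
  -- `k` would make `y` use this letter twice.
  obtain ⟨b, hb⟩ := (x.letter_bijective i).2 (y.letter i k)
  have hlt : y.letter i k < x.letter i k := lt_of_le_of_ne (h.letter_le le_rfl hxy) h.1.symm
  have hkb : k < b := by
    rcases lt_trichotomy b k with hbk | rfl | hkb
    · rw [h.2 b i (Or.inl hbk)] at hb
      exact absurd ((y.letter_bijective i).1 hb) hbk.ne
    · exact absurd hb h.1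
    · exact hkb
  refine ⟨b, hkb, fun hr => ?_, (rel_of_letter_eq hxy hb).symm, fun z hxz hzy => ⟨fun hz => ?_,
    fun hz => le_antisymm ?_ (h.letter_le hxz hzy)⟩⟩
  · have := letter_lt (i := i) hr hkb
    rw [hb] at this
    exact absurd hlt this.not_gt
  · exact (rel_of_letter_eq hxz (hb.trans hz.symm)).symm
  -- The letter sits in `z` at some `c` in the common part of `k` and `b`. Again `c < k` would
  -- repeat it in `y`, so `c ≥ k`, and sortedness bounds the letter of `z` at `k`.
  · obtain ⟨c, hc⟩ := (z.letter_bijective i).2 (y.letter i k)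
    have hbc : z.Rel b c := rel_of_letter_eq hxz (hb.trans hc.symm)
    rw [← hc]
    refine VectorPartition.letter_le (hz.trans hbc) ?_
    by_contra! hck
    rw [h.letter_eq hxz hzy (Or.inl hck)] at hc
    exact hck.ne ((y.letter_bijective i).1 hc)

/-! ### The labels of the edges not starting at `⊥` -/

/-- The label of the edge `x ⋖ y`. -/
noncomputable def edgeLabel (x y : VectorPartition n s) : ℤ ×ₗ ℤ ×ₗ ℤ :=
  if h : x.firstAtom = y.firstAtom then toLex ((n : ℤ), toLex ((x.mergeMax y : ℤ), 0))
  else (changeTriples x.firstAtom y.firstAtom).min' (changeTriples_nonempty h)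

/-- The triple `(k, i, j)` of integers. -/
def triple (k : Fin n) (i : Fin s) (j : Fin n) : ℤ ×ₗ ℤ ×ₗ ℤ :=
  toLex ((k : ℤ) + 1, toLex ((i : ℤ) + 1, (j : ℤ) + 1))

theorem toLex_lt_toLex_iff {a b c a' b' c' : ℤ} :
    (toLex (a, toLex (b, c)) : ℤ ×ₗ ℤ ×ₗ ℤ) < toLex (a', toLex (b', c')) ↔
      a < a' ∨ a = a' ∧ (b < b' ∨ b = b' ∧ c < c') := by
  simp [Prod.Lex.toLex_lt_toLex]

theorem triple_lt_triple_iff {k k' : Fin n} {i i' : Fin s} {j j' : Fin n} :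
    triple k i j < triple k' i' j' ↔ k < k' ∨ k = k' ∧ (i < i' ∨ i = i' ∧ j < j') := by
  rw [triple, triple, toLex_lt_toLex_iff]
  simp only [Fin.ext_iff, Fin.lt_def]
  omega

theorem edgeLabel_of_eq {x y : VectorPartition n s} (h : x.firstAtom = y.firstAtom) :
    edgeLabel x y = toLex ((n : ℤ), toLex ((x.mergeMax y : ℤ), 0)) :=
  dif_pos h

theorem mem_changeTriples_iff {x y : VectorPartition n s} {t : ℤ ×ₗ ℤ ×ₗ ℤ} :
    t ∈ changeTriples x.firstAtom y.firstAtom ↔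
      ∃ k i, x.letter i k ≠ y.letter i k ∧ triple k i (y.letter i k) = t := by
  simp [changeTriples, letter, triple]

/-- `hk` puts the triple below the labels `(n, _, 0)` of edges with constant first atom, leaving
only changed letters to compare. -/
theorem triple_lt_edgeLabel {x y : VectorPartition n s} {k : Fin n} {i : Fin s} {j : Fin n}
    (hk : (k : ℕ) + 1 < n)
    (h : ∀ k' i', x.letter i' k' ≠ y.letter i' k' → triple k i j < triple k' i' (y.letter i' k')) :
    triple k i j < edgeLabel x y := by
  by_cases hxy : x.firstAtom = y.firstAtom
  · rw [edgeLabel_of_eq hxy, triple, toLex_lt_toLex_iff]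
    omega
  · rw [edgeLabel, dif_neg hxy, lt_min'_iff]
    intro t ht
    obtain ⟨k', i', hne, rfl⟩ := mem_changeTriples_iff.1 ht
    exact h k' i' hne

theorem FirstDiff.edgeLabel_eq {x y z : VectorPartition n s} {k : Fin n} {i : Fin s}
    (h : FirstDiff x y k i) (hxz : x ≤ z) (hzy : z ≤ y) (hz : z.letter i k = y.letter i k) :
    edgeLabel x z = triple k i (y.letter i k) := by
  have hne : x.letter i k ≠ z.letter i k := hz ▸ h.1
  have hxz' : x.firstAtom ≠ z.firstAtom := fun h => hne (firstAtom_eq_iff.1 h i k)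
  rw [edgeLabel, dif_neg hxz']
  refine le_antisymm (min'_le _ _ (mem_changeTriples_iff.2 ⟨k, i, hne, by rw [hz]⟩))
    (le_min' _ _ _ fun t ht => ?_)
  obtain ⟨k', i', hne', rfl⟩ := mem_changeTriples_iff.1 ht
  rw [← not_lt, triple_lt_triple_iff]
  rintro (hlt | ⟨rfl, hlt | ⟨rfl, hlt⟩⟩)
  · exact hne' ((h.2 k' i' (Or.inl hlt)).trans (h.letter_eq hxz hzy (Or.inl hlt)).symm)
  · exact hne' ((h.2 _ i' (Or.inr ⟨rfl, hlt⟩)).trans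
      (h.letter_eq hxz hzy (Or.inr ⟨rfl, hlt⟩)).symm)
  · exact hlt.ne hz

/-- Both ends agree with `y` before `(k, i)`, so no letter changes there. By `hu`, a change at `(k,
i)` itself produces a letter other than that of `y`, hence a larger one. -/
theorem FirstDiff.triple_lt_edgeLabel {x y u z : VectorPartition n s} {k : Fin n} {i : Fin s}
    (h : FirstDiff x y k i) (hxy : x ≤ y) (hxu : x ≤ u) (huz : u ≤ z) (hzy : z ≤ y)
    (hu : u.letter i k = y.letter i k ∨ z.letter i k ≠ y.letter i k) :
    triple k i (y.letter i k) < edgeLabel u z := by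
  obtain ⟨b, hkb, -⟩ := h.exists_rel hxy
  refine VectorPartition.triple_lt_edgeLabel ?_ fun k' i' hne => ?_
  · have := b.isLt
    rw [Fin.lt_def] at hkb
    omega
  have hbefore : ¬ (k' < k ∨ k' = k ∧ i' < i) := fun hlt =>
    hne ((h.letter_eq hxu (huz.trans hzy) hlt).trans (h.letter_eq (hxu.trans huz) hzy hlt).symm)
  rw [triple_lt_triple_iff]
  rcases lt_trichotomy k k' with hk | rfl | hk
  · exact Or.inl hk
  · rcases lt_trichotomy i i' with hi | rfl | hi
    · exact Or.inr ⟨rfl, Or.inl hi⟩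
    · refine Or.inr ⟨rfl, Or.inr ⟨rfl, ?_⟩⟩
      refine lt_of_le_of_ne (h.letter_le (hxu.trans huz) hzy) fun heq => ?_
      rcases hu with hu | hu
      · exact hne (hu.trans heq)
      · exact hu heq.symm
    · exact absurd (Or.inr ⟨rfl, hi⟩) hbefore
  · exact absurd (Or.inl hk) hbefore

/-- Applied to `[z', y]` with the letter at `(k, i)` still wrong, this supplies the second edge
required by the criterion. -/
theorem FirstDiff.exists_covBy {x y : VectorPartition n s} {k : Fin n} {i : Fin s}
    (h : FirstDiff x y k i) (hxy : x ≤ y) :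
    ∃ z, x ⋖ z ∧ z ≤ y ∧ edgeLabel x z = triple k i (y.letter i k) := by
  obtain ⟨b, -, hx, hy, hb⟩ := h.exists_rel hxy
  have hle := merge_le hxy hy
  exact ⟨_, covBy_merge hx, hle, h.edgeLabel_eq (x.le_merge k b) hle
    ((hb _ (x.le_merge k b) hle).2 (x.rel_merge_self k b))⟩

/-- The interval `[x, y]` satisfies the local criterion for EL-labelings. -/
def HasLeastEdge (x y : VectorPartition n s) : Prop :=
  ∃ z, x ⋖ z ∧ z ≤ y ∧
    (∀ z', x ⋖ z' → z' ≤ y → z' ≠ z → edgeLabel x z < edgeLabel x z' ∧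
      ∃ u, z' ⋖ u ∧ u ≤ y ∧ edgeLabel z' u ≤ edgeLabel x z') ∧
    ∀ u, z ⋖ u → u ≤ y → edgeLabel x z < edgeLabel z u

theorem hasLeastEdge_of_firstAtom_ne {x y : VectorPartition n s} (hxy : x ≤ y)
    (hne : x.firstAtom ≠ y.firstAtom) : HasLeastEdge x y := by
  obtain ⟨k, i, h⟩ := exists_firstDiff hne
  obtain ⟨b, -, hx, hy, hb⟩ := h.exists_rel hxy
  have hle := merge_le hxy hy
  have hz := (hb _ (x.le_merge k b) hle).2 (x.rel_merge_self k b)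
  have hlab := h.edgeLabel_eq (x.le_merge k b) hle hz
  refine ⟨x.merge k b, covBy_merge hx, hle, fun z' hz' hz'y hne' => ?_, fun u hu huy => ?_⟩
  · have hdiff : z'.letter i k ≠ y.letter i k := fun heq =>
      hne' (eq_merge_of_covBy hz' ((hb z' hz'.le hz'y).1 heq) hx)
    have hlt := h.triple_lt_edgeLabel hxy le_rfl hz'.le hz'y (Or.inr hdiff)
    obtain ⟨u, hu, huy, hulab⟩ := (h.of_le hz'.le hz'y hdiff).exists_covBy hz'y
    rw [hlab]
    exact ⟨hlt, u, hu, huy, hulab.trans_le hlt.le⟩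
  · rw [hlab]
    exact h.triple_lt_edgeLabel hxy (x.le_merge k b) hu.le huy (Or.inl hz)

/-! ### Intervals on which the first atom is constant -/

/-- `a` is the largest element of its part. -/
def IsPartMax (x : VectorPartition n s) (a : Fin n) : Prop :=
  ∀ c, x.Rel a c → c ≤ a

theorem exists_isPartMax (x : VectorPartition n s) (a : Fin n) :
    ∃ c, x.Rel a c ∧ x.IsPartMax c := by
  obtain ⟨c, hc, hmax⟩ := exists_max_image (x.partition.part a) id ⟨a, x.mem_part_self a⟩
  have hac := mem_part_iff_rel.1 hc
  exact ⟨c, hac, fun d hd => hmax d (mem_part_iff_rel.2 (hac.trans hd))⟩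

theorem IsPartMax.eq_of_rel {x : VectorPartition n s} {a b : Fin n} (ha : x.IsPartMax a)
    (hb : x.IsPartMax b) (h : x.Rel a b) : a = b :=
  le_antisymm (hb a h.symm) (ha b h)

theorem IsPartMax.of_le {x z : VectorPartition n s} (h : x ≤ z) {a : Fin n}
    (ha : z.IsPartMax a) : x.IsPartMax a :=
  fun c hc => ha c (rel_of_le h hc)

/-- Two parts of `x`, given by their largest elements `a < b`, contained in a part of `y`. -/
structure MergePair (x y : VectorPartition n s) (a b : Fin n) : Prop where
  lt : a < b
  left : x.IsPartMax a
  right : x.IsPartMax b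
  rel : y.Rel a b

theorem MergePair.not_rel {x y : VectorPartition n s} {a b : Fin n} (h : MergePair x y a b) :
    ¬ x.Rel a b :=
  fun hr => h.lt.ne (h.left.eq_of_rel h.right hr)

theorem exists_mergePair {x y : VectorPartition n s} (h : x < y) : ∃ a b, MergePair x y a b := by
  obtain ⟨a, b, hab, hnab⟩ := exists_rel_of_lt h
  obtain ⟨c, hac, hc⟩ := x.exists_isPartMax a
  obtain ⟨d, hbd, hd⟩ := x.exists_isPartMax b
  have hcd : y.Rel c d := (rel_of_le h.le hac.symm).trans (hab.trans (rel_of_le h.le hbd))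
  rcases lt_trichotomy c d with hlt | rfl | hlt
  · exact ⟨c, d, hlt, hc, hd, hcd⟩
  · exact absurd (hac.trans hbd.symm) hnab
  · exact ⟨d, c, hlt, hd, hc, hcd.symm⟩

/-- If `x ⋖ z` then `z` is obtained by merging the parts of a pair. -/
theorem exists_mergePair_of_covBy {x y z : VectorPartition n s} (h : x ⋖ z) (hzy : z ≤ y) :
    ∃ a b, MergePair x y a b ∧ z = x.merge a b := by
  obtain ⟨a, b, hab⟩ := exists_mergePair h.lt
  exact ⟨a, b, ⟨hab.lt, hab.left, hab.right, rel_of_le hzy hab.rel⟩,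
    eq_merge_of_covBy h hab.rel hab.not_rel⟩

/-- A part of `x` survives iff it is neither of the two merged parts; if one of these survived, `a`
and `b` would already be related in `x`. -/
theorem MergePair.mem_merged_iff {x y : VectorPartition n s} {a b : Fin n}
    (h : MergePair x y a b) {c : Fin n} :
    c ∈ (x.partition.parts \ (x.merge a b).partition.parts).biUnion id ↔
      x.Rel a c ∨ x.Rel b c := by
  have hkey : x.partition.part c ∈ (x.merge a b).partition.parts ↔
      x.partition.part c = (x.merge a b).partition.part c :=
    ⟨fun hc => ((x.merge a b).partition.part_eq_of_mem hc (x.mem_part_self c)).symm,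
      fun hc => hc ▸ part_mem_parts _ c⟩
  have hkey' : x.partition.part c = (x.merge a b).partition.part c ↔
      ¬ (x.Rel a c ∨ x.Rel b c) := by
    constructor
    · intro heq hc
      have hr : ∀ d, x.Rel a d ∨ x.Rel b d → x.Rel c d := fun d hd => by
        rw [← mem_part_iff_rel, heq, mem_part_iff_rel, rel_merge]
        exact Or.inr ⟨hc, hd⟩
      exact h.not_rel ((hr a (Or.inl (Rel.refl x a))).symm.trans (hr b (Or.inr (Rel.refl x b))))
    · intro hc
      ext d
      rw [mem_part_iff_rel, mem_part_iff_rel, rel_merge]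
      tauto
  simp only [mem_biUnion, mem_sdiff, id]
  constructor
  · rintro ⟨I, ⟨hI, hI'⟩, hc⟩
    rw [← x.partition.part_eq_of_mem hI hc, hkey, hkey', not_not] at hI'
    exact hI'
  · intro hc
    exact ⟨_, ⟨x.part_mem_parts c, fun h' => hkey'.1 (hkey.1 h') hc⟩, x.mem_part_self c⟩

theorem MergePair.mergeMax_eq {x y : VectorPartition n s} {a b : Fin n}
    (h : MergePair x y a b) : x.mergeMax (x.merge a b) = (b : ℕ) + 1 := by
  refine le_antisymm (Finset.sup_le fun c hc => ?_)
    (le_sup (f := fun c : Fin n => (c : ℕ) + 1) (h.mem_merged_iff.2 (Or.inr (Rel.refl x b))))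
  rcases h.mem_merged_iff.1 hc with hc | hc
  · have := (h.left c hc).trans h.lt.le
    rw [Fin.le_def] at this
    omega
  · have := h.right c hc
    rw [Fin.le_def] at this
    omega

theorem MergePair.merge_le {x y : VectorPartition n s} {a b : Fin n} (h : MergePair x y a b)
    (hxy : x ≤ y) : x.merge a b ≤ y :=
  VectorPartition.merge_le hxy h.rel

theorem MergePair.edgeLabel_eq {x y : VectorPartition n s} {a b : Fin n}
    (h : MergePair x y a b) (hxy : x ≤ y) (heq : x.firstAtom = y.firstAtom) :
    edgeLabel x (x.merge a b) = toLex ((n : ℤ), toLex ((b : ℤ) + 1, 0)) := by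
  rw [edgeLabel_of_eq (heq.trans
    (firstAtom_eq_of_le_of_le (x.le_merge a b) (h.merge_le hxy) heq).symm), h.mergeMax_eq]
  push_cast
  rfl

/-- The largest elements of the parts are the same after merging, except for the smaller of those
of the two merged parts. -/
theorem MergePair.isPartMax_merge_iff {x y : VectorPartition n s} {a b : Fin n}
    (h : MergePair x y a b) {c : Fin n} :
    (x.merge a b).IsPartMax c ↔ x.IsPartMax c ∧ c ≠ a := by
  constructor
  · refine fun hc => ⟨hc.of_le (x.le_merge a b), ?_⟩
    rintro rfl
    exact absurd (hc b (x.rel_merge_self c b)) h.lt.not_ge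
  · rintro ⟨hc, hca⟩ d hd
    rcases rel_merge.1 hd with hcd | ⟨hac | hbc, had | hbd⟩
    · exact hc d hcd
    · exact absurd (h.left.eq_of_rel hc hac).symm hca
    · exact absurd (h.left.eq_of_rel hc hac).symm hca
    · exact (h.left d had).trans (h.lt.le.trans (hc b hbc.symm))
    · exact hc d (hbc.symm.trans hbd)

theorem hasLeastEdge_of_firstAtom_eq {x y : VectorPartition n s} (hxy : x < y)
    (heq : x.firstAtom = y.firstAtom) : HasLeastEdge x y := by
  obtain ⟨b, ⟨a, hab⟩, hmin⟩ :=
    wellFounded_lt.has_min {b : Fin n | ∃ a, MergePair x y a b}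
      (by obtain ⟨a, b, h⟩ := exists_mergePair hxy; exact ⟨b, a, h⟩)
  replace hmin : ∀ {a' b'}, MergePair x y a' b' → b ≤ b' := fun {a' b'} h =>
    not_lt.1 (hmin b' ⟨a', h⟩)
  -- Two different part maxima below `b` in its part of `y` would form a pair whose larger element
  -- is below `b`.
  have huniq : ∀ c, x.IsPartMax c → y.Rel c b → c < b → c = a := by
    intro c hc hcb hlt
    rcases lt_trichotomy c a with h | h | h
    · exact absurd (hmin ⟨h, hc, hab.left, hcb.trans hab.rel.symm⟩) hab.lt.not_ge
    · exact h
    · exact absurd (hmin ⟨h, hab.left, hc, hab.rel.trans hcb.symm⟩) hlt.not_ge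
  have hlab := hab.edgeLabel_eq hxy.le heq
  refine ⟨x.merge a b, covBy_merge hab.not_rel, hab.merge_le hxy.le,
    fun z' hz' hz'y hne => ?_, fun u hu huy => ?_⟩
  · obtain ⟨a', b', hab', rfl⟩ := exists_mergePair_of_covBy hz' hz'y
    have hbb' : b < b' := by
      refine lt_of_le_of_ne (hmin hab') ?_
      rintro rfl
      exact hne (by rw [huniq a' hab'.left hab'.rel hab'.lt])
    -- Among the part maxima only `a'` is lost, so at least two of `a < b < b'` remain usable: `b,
    -- b'` if `a' = a`; `a, b'` if `a' = b`; otherwise `a, b`.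
    have hpair : ∃ p q, MergePair (x.merge a' b') y p q ∧ q ≤ b' := by
      have hb' : (x.merge a' b').IsPartMax b' :=
        hab'.isPartMax_merge_iff.2 ⟨hab'.right, hab'.lt.ne'⟩
      by_cases ha' : a = a'
      · have hb : (x.merge a' b').IsPartMax b :=
          hab'.isPartMax_merge_iff.2 ⟨hab.right, ha' ▸ hab.lt.ne'⟩
        exact ⟨b, b', ⟨hbb', hb, hb', hab.rel.symm.trans (ha' ▸ hab'.rel)⟩, le_rfl⟩
      · have ha : (x.merge a' b').IsPartMax a := hab'.isPartMax_merge_iff.2 ⟨hab.left, ha'⟩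
        by_cases hb'' : b = a'
        · exact ⟨a, b', ⟨hab.lt.trans hbb', ha, hb', hab.rel.trans (hb'' ▸ hab'.rel)⟩, le_rfl⟩
        · have hb : (x.merge a' b').IsPartMax b :=
            hab'.isPartMax_merge_iff.2 ⟨hab.right, hb''⟩
          exact ⟨a, b, ⟨hab.lt, ha, hb, hab.rel⟩, hbb'.le⟩
    obtain ⟨p, q, hpq, hq⟩ := hpair
    refine ⟨?_, _, covBy_merge hpq.not_rel, hpq.merge_le hz'y, ?_⟩
    · rw [hlab, hab'.edgeLabel_eq hxy.le heq, toLex_lt_toLex_iff]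
      rw [Fin.lt_def] at hbb'
      omega
    · rw [hpq.edgeLabel_eq hz'y (firstAtom_eq_of_le_of_le hz'.le hz'y heq),
        hab'.edgeLabel_eq hxy.le heq, ← not_lt, toLex_lt_toLex_iff]
      rw [Fin.le_def] at hq
      omega
  · have hzy := hab.merge_le hxy.le
    obtain ⟨a', b', hab', rfl⟩ := exists_mergePair_of_covBy hu huy
    obtain ⟨ha', hne⟩ := hab.isPartMax_merge_iff.1 hab'.left
    have hab'' : MergePair x y a' b' :=
      ⟨hab'.lt, ha', (hab.isPartMax_merge_iff.1 hab'.right).1, hab'.rel⟩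
    -- Equality would force `a' = a`, but `a` is no longer a part maximum.
    have hbb' : b < b' := by
      refine lt_of_le_of_ne (hmin hab'') ?_
      rintro rfl
      exact hne (huniq a' ha' hab'.rel hab'.lt)
    rw [hlab, hab'.edgeLabel_eq hzy (firstAtom_eq_of_le_of_le (x.le_merge a b) hzy heq),
      toLex_lt_toLex_iff]
    rw [Fin.lt_def] at hbb'
    omega

theorem hasLeastEdge_of_lt {x y : VectorPartition n s} (h : x < y) : HasLeastEdge x y := by
  by_cases heq : x.firstAtom = y.firstAtom
  · exact hasLeastEdge_of_firstAtom_eq h heq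
  · exact hasLeastEdge_of_firstAtom_ne h.le heq

/-! ### The edges starting at `⊥` -/

theorem IsMin.rel_iff {a : VectorPartition n s} (ha : IsMin a) {c d : Fin n} :
    a.Rel c d ↔ c = d := by
  obtain ⟨V, rfl⟩ := isMin_iff_exists_eq_ofPerm.1 ha
  exact rel_ofPerm_bot

theorem word_eq_firstAtom {a : VectorPartition n s} (ha : IsMin a) : a.word = a.firstAtom := by
  obtain ⟨V, rfl⟩ := isMin_iff_exists_eq_ofPerm.1 ha
  refine (firstAtom_eq_word (fun i c d hcd hlt => ?_) fun i c d => mem_label_ofPerm).symm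
  exact absurd (rel_ofPerm_bot.1 hcd) hlt.ne

theorem eq_of_firstAtom_eq {a b : VectorPartition n s} (ha : IsMin a) (hb : IsMin b)
    (h : a.firstAtom = b.firstAtom) : a = b := by
  refine le_antisymm (le_iff.2 ⟨fun c d hcd => ?_, fun i c d hcd => ?_⟩)
    (le_iff.2 ⟨fun c d hcd => ?_, fun i c d hcd => ?_⟩)
  · exact (IsMin.rel_iff hb).2 ((IsMin.rel_iff ha).1 hcd)
  · exact (IsMin.rel_iff hb).2
      ((b.letter_bijective i).1 ((firstAtom_eq_iff.1 h i c).symm.trans hcd))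
  · exact (IsMin.rel_iff ha).2 ((IsMin.rel_iff hb).1 hcd)
  · exact (IsMin.rel_iff ha).2
      ((a.letter_bijective i).1 ((firstAtom_eq_iff.1 h i c).trans hcd))

theorem exists_isMin_le_word_eq (y : VectorPartition n s) :
    ∃ a, IsMin a ∧ a ≤ y ∧ a.word = y.firstAtom := by
  obtain ⟨a, ha, haw⟩ := mem_image.1 (min'_mem _ (y.atomsBelow_nonempty.image word))
  obtain ⟨ha, hay⟩ := mem_atomsBelow_iff.1 ha
  exact ⟨a, ha, hay, haw⟩

theorem firstAtom_le_word {a y : VectorPartition n s} (ha : IsMin a) (hay : a ≤ y) :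
    y.firstAtom ≤ a.word :=
  min'_le _ _ (mem_image_of_mem _ (mem_atomsBelow_iff.2 ⟨ha, hay⟩))

theorem atomRank_lt_atomRank {a b : VectorPartition n s} (hb : IsMin b) (h : a.word < b.word) :
    a.atomRank < b.atomRank := by
  refine card_lt_card ((ssubset_iff_of_subset fun c hc => ?_).2 ⟨b, ?_, fun hc => ?_⟩)
  · rw [mem_filter] at hc ⊢
    exact ⟨hc.1, hc.2.trans h.le⟩
  · exact mem_filter.2 ⟨mem_atoms_iff.2 hb, le_rfl⟩
  · exact h.not_ge (mem_filter.1 hc).2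

theorem atomRank_pos {a : VectorPartition n s} (ha : IsMin a) : 0 < a.atomRank :=
  card_pos.2 ⟨a, mem_filter.2 ⟨mem_atoms_iff.2 ha, le_rfl⟩⟩

/-- The label of the edge from `⊥` to the atom `a`. -/
noncomputable def atomLabel (a : VectorPartition n s) : ℤ ×ₗ ℤ ×ₗ ℤ :=
  toLex ((n : ℤ) - 1, toLex ((s : ℤ) + a.atomRank, 0))

theorem exists_first_atom_edge (y : VectorPartition n s) :
    ∃ z, IsMin z ∧ z ≤ y ∧
      (∀ z', IsMin z' → z' ≤ y → z' ≠ z → atomLabel z < atomLabel z' ∧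
        ∃ u, z' ⋖ u ∧ u ≤ y ∧ edgeLabel z' u ≤ atomLabel z') ∧
      ∀ u, z ⋖ u → u ≤ y → atomLabel z < edgeLabel z u := by
  obtain ⟨z, hz, hzy, hzw⟩ := y.exists_isMin_le_word_eq
  have hzA : z.firstAtom = y.firstAtom := (word_eq_firstAtom hz).symm.trans hzw
  refine ⟨z, hz, hzy, fun z' hz' hz'y hne => ?_, fun u hu huy => ?_⟩
  · have hA : z'.firstAtom ≠ y.firstAtom := fun h =>
      hne (eq_of_firstAtom_eq hz' hz (h.trans hzA.symm))
    have hlt : z.word < z'.word := by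
      rw [hzw]
      refine lt_of_le_of_ne (firstAtom_le_word hz' hz'y) fun h => hA ?_
      rw [← word_eq_firstAtom hz', h]
    obtain ⟨k, i, hd⟩ := exists_firstDiff hA
    obtain ⟨u, hu, huy, hlab⟩ := hd.exists_covBy hz'y
    refine ⟨?_, u, hu, huy, ?_⟩
    · have := atomRank_lt_atomRank hz' hlt
      rw [atomLabel, atomLabel, toLex_lt_toLex_iff]
      omega
    -- Since `k < b`, the first entry `k + 1` is at most `n - 1`. In case of equality the second
    -- entry decides: `i + 1 ≤ s`, while the rank is positive.
    · obtain ⟨b, hkb, -⟩ := hd.exists_rel hz'y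
      have hb := b.isLt
      have hi := i.isLt
      have hpos := atomRank_pos hz'
      rw [Fin.lt_def] at hkb
      rw [hlab, triple, atomLabel]
      refine le_of_lt ?_
      rw [toLex_lt_toLex_iff]
      omega
  · rw [edgeLabel_of_eq (hzA.trans (firstAtom_eq_of_le_of_le hu.le huy hzA).symm), atomLabel,
      toLex_lt_toLex_iff]
    omega

end VectorPartition

/-! ### Transfer to the poset with `⊥` adjoined -/

open VectorPartition in
theorem isELLabeling_vectorPartitionLabeling (n s : ℕ) :
    IsELLabeling (vectorPartitionLabeling n s) := by
  refine isELLabeling_of_exists_covBy _ fun x y hxy => ?_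
  induction y using WithBot.recBotCoe with
  | bot => exact absurd hxy not_lt_bot
  | coe y =>
  induction x using WithBot.recBotCoe with
  | bot =>
    obtain ⟨z, hz, hzy, hother, hnext⟩ := exists_first_atom_edge y
    refine ⟨z, WithBot.bot_covBy_coe.2 hz, WithBot.coe_le_coe.2 hzy,
      fun z' hz' hz'y hne => ?_, fun u hu huy => ?_⟩
    · induction z' using WithBot.recBotCoe with
      | bot => exact absurd hz'.lt not_lt_bot
      | coe z' =>
      obtain ⟨h, u, hu, huy, hle⟩ := hother z' (WithBot.bot_covBy_coe.1 hz')
        (WithBot.coe_le_coe.1 hz'y) fun h => hne (by rw [h])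
      exact ⟨h, u, WithBot.coe_covBy_coe.2 hu, WithBot.coe_le_coe.2 huy, hle⟩
    · induction u using WithBot.recBotCoe with
      | bot => exact absurd hu.lt not_lt_bot
      | coe u => exact hnext u (WithBot.coe_covBy_coe.1 hu) (WithBot.coe_le_coe.1 huy)
  | coe x =>
    obtain ⟨z, hz, hzy, hother, hnext⟩ := hasLeastEdge_of_lt (WithBot.coe_lt_coe.1 hxy)
    refine ⟨z, WithBot.coe_covBy_coe.2 hz, WithBot.coe_le_coe.2 hzy,
      fun z' hz' hz'y hne => ?_, fun u hu huy => ?_⟩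
    · induction z' using WithBot.recBotCoe with
      | bot => exact absurd hz'.lt not_lt_bot
      | coe z' =>
      obtain ⟨h, u, hu, huy, hle⟩ := hother z' (WithBot.coe_covBy_coe.1 hz')
        (WithBot.coe_le_coe.1 hz'y) fun h => hne (by rw [h])
      exact ⟨h, u, WithBot.coe_covBy_coe.2 hu, WithBot.coe_le_coe.2 huy, hle⟩
    · induction u using WithBot.recBotCoe with
      | bot => exact absurd hu.lt not_lt_bot
      | coe u => exact hnext u (WithBot.coe_covBy_coe.1 hu) (WithBot.coe_le_coe.1 huy)

theorem theorem3p3 (n s : ℕ) (hn : 1 ≤ n) :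
    IsELLabeling (vectorPartitionLabeling n s) ∧ ELShellable (VectorPartitionPoset n s) :=
  ⟨isELLabeling_vectorPartitionLabeling n s,
    _, _, _, isELLabeling_vectorPartitionLabeling n s⟩
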